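/- Consider the \textsc{Congested Clique} model: $n$ nodes $1,\dots,n$ that know $n$ and their own identifiers proceed in synchronous rounds; in each round every node sends a (possibly different) message of $O(\log n)$ bits to every other node; local computation is unrestricted, and only rounds are counted. To multiply two $n\times n$ matrices $S,T$ over a semiring $R$, node $v$ receives row $v$ of $S$ and row $v$ of $T$ as input and has to output row $v$ of $P=S\cdot T$. As usual, semiring values are assumed to fit into $O(\log n)$ bits: there is a set $V\subseteq R$ with $|V|\le 2^{\kappa\lceil\log_2(n+1)\rceil}$, for a constant $\kappa$, that contains all entries of $S$ and $T$ and all partial sums $\sum_{k\in K}S[i][k]\,T[k][j]$ with $i,j\in[n]$, $K\subseteq[n]$. Let $nz(A)$ denote the number of nonzero entries of a matrix $A$. For all constants $\kappa \in \mathbb{N}$ and $\beta\ge 1$ an integer there is a constant $C$ such that for every $n$, every semiring $R$ and every finite $V\subseteq R$ with $|V|\le 2^{\kappa\lceil\log_2(n+1)\rceil}$ there is a deterministic \textsc{Congested Clique} algorithm with messages of $\beta\lceil\log_2(n+1)\rceil$ bits that computes $P=S\cdot T$ for all $n\times n$ matrices $S,T$ over $R$ whose entries and partial sums, as above, lie in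 $V$, and that does so within $$C\left(\left(\frac{m}{n}\right)^{1/3}+1\right)\ \text{ rounds},\qquad m=\min\{nz(S),nz(T)\}$$ (where $m/n$ is read as $0$ if $n=0$). The algorithm is not given $m$, $nz(S)$ or $nz(T)$, and the matrix with more nonzero entries may be dense. -/

import Mathlib

universe u

/-- The bandwidth unit of an `n`-node clique, `⌈log₂ (n + 1)⌉` bits
(the number of binary digits of `n`). -/
def wordBits (n : ℕ) : ℕ := Nat.clog 2 (n + 1)

/-- A message of exactly `B` bits. -/
abbrev Message (B : ℕ) : Type := Fin B → Bool

/-- A deterministic algorithm for the congested clique on the nodes `Fin n` with `B`-bit messages,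
in which each node gets a local input in `In` and has to produce a local output in `Out`.
All nodes run the same program, which knows the identifier of the node it runs on. Local
computation and memory are unrestricted. -/
structure CliqueAlgorithm (n B : ℕ) (In Out : Type u) where
  /-- local states of a node -/
  State : Type u
  /-- initial state, from the identifier and the local input of the node -/
  init : Fin n → In → State
  /-- `send σ u` is the message that a node in state `σ` sends to node `u` in the next round -/
  send : State → Fin n → Message B
  /-- new state after a round, from the old one and the messages received, indexed by sender -/
  step : State → (Fin n → Message B) → State
  /-- `none` as long as the node has not produced its output -/
  output : State → Option Out

namespace CliqueAlgorithm

variable {n B : ℕ} {In Out : Type u}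

/-- `A.run x t v` is the state of node `v` after `t` synchronous rounds on the input `x`. -/
def run (A : CliqueAlgorithm n B In Out) (x : Fin n → In) : ℕ → Fin n → A.State
  | 0 => fun v => A.init v (x v)
  | t + 1 => fun v => A.step (A.run x t v) (fun u => A.send (A.run x t u) v)

/-- On the input `x`, the algorithm computes the output `y` (node `v` outputs `y v`) within `r`
rounds: no node ever produces a wrong output, and from round `r` on every node has produced its
output. -/
def ComputesWithin (A : CliqueAlgorithm n B In Out) (x : Fin n → In) (y : Fin n → Out)
    (r : ℕ) : Prop :=
  (∀ t v o, A.output (A.run x t v) = some o → o = y v) ∧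
    ∀ t, r ≤ t → ∀ v, A.output (A.run x t v) = some (y v)

end CliqueAlgorithm

/-- The number of nonzero entries of a matrix. -/
noncomputable def nz {n : ℕ} {R : Type u} [Semiring R] (A : Matrix (Fin n) (Fin n) R) : ℕ :=
  {p : Fin n × Fin n | A p.1 p.2 ≠ 0}.ncard

/-- The set `V` of values contains all entries of `S` and of `T`, and all partial sums
`∑ k ∈ K, S i k * T k j` of the sums that define the entries of `S * T`. -/
def ValuesIn {n : ℕ} {R : Type u} [Semiring R] (V : Finset R)
    (S T : Matrix (Fin n) (Fin n) R) : Prop :=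
  (∀ i j, S i j ∈ V) ∧ (∀ i j, T i j ∈ V) ∧
    ∀ (i j : Fin n) (K : Finset (Fin n)), ∑ k ∈ K, S i k * T k j ∈ V

/-- An algorithm for multiplying two `n × n` matrices over `R`: node `v` gets row `v` of each of
the two matrices and has to output row `v` of the product. -/
abbrev MatMulAlgorithm (n B : ℕ) (R : Type u) : Type (u + 1) :=
  CliqueAlgorithm n B ((Fin n → R) × (Fin n → R)) (Fin n → R)

/-! Local computation is free, so a protocol is described by indistinguishability relations between
global inputs: a message may be any function that is constant on what its sender cannot distinguish.
`Solves.exists_algorithm` turns such a description into an algorithm whose states are sets of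
possible inputs. Once a quantity is known to all nodes, `Reach.cases` and `Solves.cases` let the
protocol depend on it as on a constant; hence routing is needed only for communication patterns
fixed in advance.

Let `A` be the sparser factor, `T` the other one, and `q` about the cube root of `m / n`, but at
least `1`. The rows of `A` are split into `q` groups of `O(n / q)` rows and `O(q ^ 2 * n)` nonzero
entries, and for each row group the columns are split into `q` groups of `O(n / q)` columns so that
every block has `O(q * n)` nonzero entries. Each of the `q ^ 2` blocks gets `c = n / q ^ 2` (rounded
down) nodes, which share the columns of `T` in slices of `O(q ^ 2)`. Such a node needs `O(q * n)`
nonzero entries of `A` and `O(n / q) * O(q ^ 2) = O(q * n)` entries of `T`, and it produces as many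
partial sums. Every node can send and receive about `n` messages per round, so `O(q)` rounds suffice
(`reach_product`).

Both the partitions and the routing rest on the greedy colouring `exists_balanced₂`; in
`reach_route` the colours are the intermediate nodes. -/

/-! ### Knowledge in the congested clique

`K v x x'` says that node `v` cannot distinguish the global inputs `x` and `x'`. -/

/-- What the nodes know: `K v x x'` if node `v` cannot distinguish `x` from `x'`. -/
abbrev Knowledge (n : ℕ) (X : Type*) : Type _ := Fin n → X → X → Prop

namespace Knowledge

variable {n B : ℕ} {X : Type*}

/-- The knowledge after one round in which node `u` sends `M u v x` to node `v`. -/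
def learn (K : Knowledge n X) (M : Fin n → Fin n → X → Message B) : Knowledge n X :=
  fun v x x' => K v x x' ∧ ∀ u, M u v x = M u v x'

/-- The messages of a round depend on the knowledge of the senders only. -/
def Sendable (K : Knowledge n X) (M : Fin n → Fin n → X → Message B) : Prop :=
  ∀ u v x x', K u x x' → M u v x = M u v x'

/-- From the knowledge `K`, the nodes can get to the knowledge `G` (or a finer one) in `r` rounds
with `B`-bit messages. -/
def Reach (B : ℕ) : ℕ → Knowledge n X → Knowledge n X → Prop
  | 0, K, G => ∀ v x x', K v x x' → G v x x'
  | r + 1, K, G => ∃ M : Fin n → Fin n → X → Message B,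
      K.Sendable M ∧ Reach B r (K.learn M) G

/-- The restriction of `K` to the inputs on which `f` has the value `c`. -/
def fix {γ : Type*} (K : Knowledge n X) (f : X → γ) (c : γ) : Knowledge n X :=
  fun v x x' => K v x x' ∧ f x = c ∧ f x' = c

theorem Sendable.mono {K K' : Knowledge n X} {M : Fin n → Fin n → X → Message B}
    (h : ∀ v x x', K v x x' → K' v x x') (hM : K'.Sendable M) : K.Sendable M :=
  fun u v x x' hx => hM u v x x' (h _ _ _ hx)

theorem learn_mono {K K' : Knowledge n X} {M : Fin n → Fin n → X → Message B}
    (h : ∀ v x x', K v x x' → K' v x x') (v : Fin n) (x x' : X) (hx : K.learn M v x x') :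
    K'.learn M v x x' := ⟨h _ _ _ hx.1, hx.2⟩

namespace Reach

theorem mono_left {r : ℕ} {K K' G : Knowledge n X} (h : ∀ v x x', K v x x' → K' v x x')
    (hr : Reach B r K' G) : Reach B r K G := by
  induction r generalizing K K' with
  | zero => exact fun v x x' hx => hr v x x' (h _ _ _ hx)
  | succ r ih =>
    obtain ⟨M, hM, hr⟩ := hr
    exact ⟨M, hM.mono h, ih (learn_mono h) hr⟩

theorem mono_right {r : ℕ} {K G G' : Knowledge n X} (h : ∀ v x x', G v x x' → G' v x x')
    (hr : Reach B r K G) : Reach B r K G' := by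
  induction r generalizing K with
  | zero => exact fun v x x' hx => h _ _ _ (hr v x x' hx)
  | succ r ih =>
    obtain ⟨M, hM, hr⟩ := hr
    exact ⟨M, hM, ih hr⟩

theorem of_le {r : ℕ} {K G : Knowledge n X} (h : ∀ v x x', K v x x' → G v x x') :
    Reach B r K G := by
  induction r generalizing K with
  | zero => exact h
  | succ r ih => exact ⟨fun _ _ _ _ => false, fun _ _ _ _ _ => rfl, ih fun v x x' hx => h _ _ _ hx.1⟩

theorem mono_rounds {r s : ℕ} (hrs : r ≤ s) {K G : Knowledge n X} (hr : Reach B r K G) :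
    Reach B s K G := by
  induction r generalizing K s with
  | zero => exact of_le hr
  | succ r ih =>
    obtain ⟨s, rfl⟩ : ∃ t, s = t + 1 := ⟨s - 1, by omega⟩
    obtain ⟨M, hM, hr⟩ := hr
    exact ⟨M, hM, ih (by omega) hr⟩

theorem trans {r s : ℕ} {K G H : Knowledge n X} (hr : Reach B r K G) (hs : Reach B s G H) :
    Reach B (r + s) K H := by
  induction r generalizing K with
  | zero => exact (hs.mono_left hr).mono_rounds (by omega)
  | succ r ih =>
    obtain ⟨M, hM, hr⟩ := hr
    rw [Nat.succ_add]
    exact ⟨M, hM, ih hr⟩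

/-- If all nodes know `f`, then its value can be treated as a constant. -/
theorem cases {γ : Type*} (f : X → γ) {r : ℕ} {K G : Knowledge n X}
    (hf : ∀ v x x', K v x x' → f x = f x')
    (h : ∀ v x₀ x₁, K v x₀ x₁ → Reach B r (K.fix f (f x₀)) G) : Reach B r K G := by
  replace h : ∀ c, Reach B r (K.fix f c) G := by
    intro c
    by_cases hc : ∃ v x₀ x₁, K v x₀ x₁ ∧ f x₀ = c
    · obtain ⟨v, x₀, x₁, hx, rfl⟩ := hc
      exact h v x₀ x₁ hx
    · exact of_le fun v x x' hx => (hc ⟨v, x, x', hx.1, hx.2.1⟩).elim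
  induction r generalizing K with
  | zero => exact fun v x x' hx => h (f x) v x x' ⟨hx, rfl, (hf _ _ _ hx).symm⟩
  | succ r ih =>
    choose M hM hr using h
    -- The protocols for the different values of `f` are glued together: every sender knows `f x`,
    -- hence which of them is running.
    refine ⟨fun u v x => M (f x) u v x, fun u v x x' hx => ?_, ?_⟩
    · have := hf _ _ _ hx
      beta_reduce
      rw [← this]
      exact hM (f x) u v x x' ⟨hx, rfl, this.symm⟩
    · refine ih (fun v x x' hx => hf _ _ _ hx.1) fun c => (hr c).mono_left ?_
      rintro v x x' ⟨⟨hx, hm⟩, hc, hc'⟩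
      refine ⟨⟨hx, hc, hc'⟩, fun u => ?_⟩
      have := hm u
      beta_reduce at this
      rwa [hc, hc'] at this

end Reach

/-! ### Protocols whose number of rounds depends on the input -/

/-- The knowledge after `t` rounds, if the messages of round `s` are `M s`. -/
def after (K : Knowledge n X) (M : ℕ → Fin n → Fin n → X → Message B) : ℕ → Knowledge n X
  | 0 => K
  | t + 1 => (K.after M t).learn (M t)

/-- From the knowledge `K`, the nodes can get to the knowledge `G` with `B`-bit messages, in
`r x` rounds on the input `x`. -/
def Solves (B : ℕ) (K G : Knowledge n X) (r : X → ℕ) : Prop :=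
  ∃ M : ℕ → Fin n → Fin n → X → Message B, (∀ t, (K.after M t).Sendable (M t)) ∧
    ∀ x t, r x ≤ t → ∀ v x', K.after M t v x x' → G v x x'

theorem after_succ' (K : Knowledge n X) (M : ℕ → Fin n → Fin n → X → Message B) (t : ℕ) :
    K.after M (t + 1) = (K.learn (M 0)).after (fun s => M (s + 1)) t := by
  induction t with
  | zero => rfl
  | succ t ih => rw [after, ih]; rfl

theorem after_mono {K K' : Knowledge n X} {M : ℕ → Fin n → Fin n → X → Message B}
    (h : ∀ v x x', K v x x' → K' v x x') (t : ℕ) (v : Fin n) (x x' : X)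
    (hx : K.after M t v x x') : K'.after M t v x x' := by
  induction t generalizing v x x' with
  | zero => exact h _ _ _ hx
  | succ t ih => exact learn_mono ih _ _ _ hx

theorem after_le (K : Knowledge n X) (M : ℕ → Fin n → Fin n → X → Message B) (t : ℕ)
    {v : Fin n} {x x' : X} (hx : K.after M t v x x') : K v x x' := by
  induction t with
  | zero => exact hx
  | succ t ih => exact ih hx.1

namespace Solves

theorem of_le {K G : Knowledge n X} (h : ∀ v x x', K v x x' → G v x x') (r : X → ℕ) :
    Solves B K G r :=
  ⟨fun _ _ _ _ _ => false, fun _ _ _ _ _ _ => rfl, fun _ t _ _ _ hx => h _ _ _ (after_le _ _ t hx)⟩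

theorem mono_left {r : X → ℕ} {K K' G : Knowledge n X} (h : ∀ v x x', K v x x' → K' v x x')
    (hr : Solves B K' G r) : Solves B K G r := by
  obtain ⟨M, hM, hr⟩ := hr
  exact ⟨M, fun t => (hM t).mono (after_mono h t),
    fun x t ht v x' hx => hr x t ht v x' (after_mono h _ _ _ _ hx)⟩

end Solves

theorem Reach.solves {r : ℕ} {s : X → ℕ} {K H G : Knowledge n X} (hr : Reach B r K H)
    (hs : Solves B H G s) : Solves B K G (fun x => r + s x) := by
  induction r generalizing K with
  | zero => simpa using hs.mono_left hr
  | succ r ih =>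
    obtain ⟨M₀, hM₀, hr⟩ := hr
    obtain ⟨M, hM, h⟩ := ih hr
    refine ⟨fun t => Nat.casesOn t M₀ M, ?_, ?_⟩
    · rintro (_ | t)
      · exact hM₀
      · rw [after_succ']
        exact hM t
    · rintro x (_ | t) ht v x' hx
      · beta_reduce at ht
        omega
      · rw [after_succ'] at hx
        exact h x t (by beta_reduce at ht ⊢; omega) v x' hx

/-- Here the round bound may vary with the value of `f`. This is how the running time adapts to `m`,
which is not given but becomes common knowledge. -/
theorem Solves.cases {γ : Type*} (f : X → γ) {r : γ → ℕ} {K G : Knowledge n X}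
    (hf : ∀ v x x', K v x x' → f x = f x')
    (h : ∀ x₀, Solves B (K.fix f (f x₀)) G (fun _ => r (f x₀))) :
    Solves B K G (fun x => r (f x)) := by
  replace h : ∀ c, Solves B (K.fix f c) G (fun _ => r c) := by
    intro c
    by_cases hc : ∃ x₀, f x₀ = c
    · obtain ⟨x₀, rfl⟩ := hc
      exact h x₀
    · exact of_le (fun v x x' hx => (hc ⟨x, hx.2.1⟩).elim) _
  choose M hM hr using h
  have key : ∀ t v x x', K.after (fun t u v x => M (f x) t u v x) t v x x' →
      (K.fix f (f x)).after (M (f x)) t v x x' := by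
    intro t
    induction t with
    | zero => exact fun v x x' hx => ⟨hx, rfl, (hf _ _ _ hx).symm⟩
    | succ t ih =>
      refine fun v x x' hx => ⟨ih _ _ _ hx.1, fun u => ?_⟩
      have := hx.2 u
      beta_reduce at this
      rwa [← hf _ _ _ (after_le _ _ _ hx.1)] at this
  refine ⟨fun t u v x => M (f x) t u v x, fun t u v x x' hx => ?_, fun x t ht v x' hx => ?_⟩
  · have := hM (f x) t u v x x' (key _ _ _ _ hx)
    beta_reduce
    rwa [← hf _ _ _ (after_le _ _ _ hx)]
  · exact hr (f x) x t ht v x' (key _ _ _ _ hx)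

/-- A protocol that is described by what the nodes know can be run by an algorithm whose states
are the sets of inputs that a node considers possible. -/
theorem Solves.exists_algorithm {X In Out : Type u} (inp : X → Fin n → In)
    (out : X → Fin n → Out) {r : X → ℕ}
    (h : Solves B (fun v x x' => inp x v = inp x' v) (fun v x x' => out x v = out x' v) r) :
    ∃ A : CliqueAlgorithm n B In Out, ∀ x, A.ComputesWithin (inp x) (out x) (r x) := by
  classical
  obtain ⟨M, hM, hr⟩ := h
  set K : Knowledge n X := fun v x x' => inp x v = inp x' v with hK
  let A : CliqueAlgorithm n B In Out :=
    { State := ℕ × Fin n × Set X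
      init := fun v a => (0, v, {x | a = inp x v})
      -- By `Sendable`, all inputs still considered possible yield the same message, so any of them
      -- may be chosen. On an input from `X` the set is never empty, since the true input stays in
      -- it.
      send := fun σ u => if h : σ.2.2.Nonempty then M σ.1 σ.2.1 u h.some else fun _ => false
      step := fun σ msg => (σ.1 + 1, σ.2.1, {x | x ∈ σ.2.2 ∧ ∀ u, msg u = M σ.1 u σ.2.1 x})
      output := fun σ => if h : σ.2.2.Nonempty ∧ ∀ x ∈ σ.2.2, ∀ x' ∈ σ.2.2,
        out x σ.2.1 = out x' σ.2.1 then some (out h.1.some σ.2.1) else none }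
  have hrefl : ∀ x t v, K.after M t v x x := by
    intro x t v
    induction t with
    | zero => exact rfl
    | succ t ih => exact ⟨ih, fun _ => rfl⟩
  have hrun : ∀ x t v, A.run (inp x) t v = (t, v, {x' | K.after M t v x x'}) := by
    intro x t
    induction t with
    | zero => intro v; rfl
    | succ t ih =>
      intro v
      have hsend : ∀ u, A.send (A.run (inp x) t u) v = M t u v x := by
        intro u
        rw [ih]
        have hne : {x' | K.after M t u x x'}.Nonempty := ⟨x, hrefl x t u⟩
        simp only [A, dif_pos hne]
        exact (hM t u v x _ hne.some_mem).symm
      simp only [CliqueAlgorithm.run, hsend]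
      rw [ih]
      rfl
  refine ⟨A, fun x => ⟨fun t v o ho => ?_, fun t ht v => ?_⟩⟩
  · rw [hrun] at ho
    simp only [A] at ho
    split_ifs at ho with hc
    rw [← Option.some.inj ho]
    exact hc.2 _ hc.1.some_mem x (hrefl x t v)
  · rw [hrun]
    have hc : {x' | K.after M t v x x'}.Nonempty ∧ ∀ y ∈ {x' | K.after M t v x x'},
        ∀ y' ∈ {x' | K.after M t v x x'}, out y v = out y' v :=
      ⟨⟨x, hrefl x t v⟩, fun y hy y' hy' => (hr x t ht v y hy).symm.trans (hr x t ht v y' hy')⟩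
    simp only [A, dif_pos hc]
    rw [hr x t ht v _ hc.1.some_mem]

end Knowledge

/-! ### Balanced assignments -/

section Balance

variable {E Q I J : Type*} [Fintype Q] [DecidableEq Q] [DecidableEq I] [DecidableEq J]

/-- Markov's inequality: fewer than half of the colours carry more than twice the average load.
Loads are multiplied by the number of colours to avoid division. -/
theorem two_mul_card_overloaded_lt [Nonempty Q] (s : Finset E) (f : E → Q) (k : E → I) (w : E → ℕ) {W : ℕ}
    (i : I) (h : ∑ e ∈ s with k e = i, w e ≤ W) :
    2 * (Finset.univ.filter fun c : Q =>
      2 * W < Fintype.card Q * ∑ e ∈ s with k e = i ∧ f e = c, w e).card < Fintype.card Q := by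
  set bad := Finset.univ.filter fun c : Q =>
    2 * W < Fintype.card Q * ∑ e ∈ s with k e = i ∧ f e = c, w e with hbad
  have hq : 0 < Fintype.card Q := Fintype.card_pos
  have h1 : bad.card * (2 * W + 1) ≤ Fintype.card Q * W := by
    calc bad.card * (2 * W + 1) = ∑ c ∈ bad, (2 * W + 1) := by simp
      _ ≤ ∑ c ∈ bad, Fintype.card Q * ∑ e ∈ s with k e = i ∧ f e = c, w e :=
        Finset.sum_le_sum fun c hc => (Finset.mem_filter.1 hc).2
      _ ≤ ∑ c, Fintype.card Q * ∑ e ∈ s with k e = i ∧ f e = c, w e :=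
        Finset.sum_le_sum_of_subset (Finset.subset_univ _)
      _ = Fintype.card Q * ∑ e ∈ s with k e = i, w e := by
        rw [← Finset.mul_sum, ← Finset.sum_fiberwise (s.filter fun e => k e = i) f w]
        simp only [Finset.filter_filter]
      _ ≤ _ := Nat.mul_le_mul_left _ h
  by_contra! hc
  nlinarith

/-- Invariant of the greedy colouring: a colour that is not overloaded can take one more item, at
the cost of a single weight, at most `M`. -/
theorem sum_filter_update_le [DecidableEq E] (s : Finset E) {a : E} (ha : a ∉ s) (f : E → Q) (k : E → I)
    (w : E → ℕ) {W M : ℕ} (hM : w a ≤ M) (c : Q)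
    (hf : ∀ i c', Fintype.card Q * ∑ e ∈ s with k e = i ∧ f e = c', w e
      ≤ 2 * W + Fintype.card Q * M)
    (hc : Fintype.card Q * ∑ e ∈ s with k e = k a ∧ f e = c, w e ≤ 2 * W) (i : I) (c' : Q) :
    Fintype.card Q * ∑ e ∈ insert a s with k e = i ∧ Function.update f a c e = c', w e
      ≤ 2 * W + Fintype.card Q * M := by
  have hs : s.filter (fun e => k e = i ∧ Function.update f a c e = c')
      = s.filter (fun e => k e = i ∧ f e = c') := by
    refine Finset.filter_congr fun e he => ?_
    have hne : e ≠ a := fun h => ha (h ▸ he)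
    rw [Function.update_of_ne hne]
  rw [Finset.filter_insert, hs]
  split_ifs with h
  · rw [Function.update_self] at h
    obtain ⟨rfl, rfl⟩ := h
    rw [Finset.sum_insert (by simp [ha]), mul_add]
    have := Nat.mul_le_mul_left (Fintype.card Q) hM
    omega
  · exact hf i c'

/-- Items with two keys and a weight for each of them can be coloured so that, for each value of
either key, the total weight is distributed almost evenly among the colours. -/
theorem exists_balanced₂ [Nonempty Q] [Fintype E] (k₁ : E → I) (k₂ : E → J) (w₁ w₂ : E → ℕ) {W₁ W₂ M₁ M₂ : ℕ}
    (h₁ : ∀ i, ∑ e with k₁ e = i, w₁ e ≤ W₁) (h₂ : ∀ j, ∑ e with k₂ e = j, w₂ e ≤ W₂)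
    (hM₁ : ∀ e, w₁ e ≤ M₁) (hM₂ : ∀ e, w₂ e ≤ M₂) :
    ∃ f : E → Q,
      (∀ i c, Fintype.card Q * ∑ e with k₁ e = i ∧ f e = c, w₁ e
        ≤ 2 * W₁ + Fintype.card Q * M₁) ∧
      ∀ j c, Fintype.card Q * ∑ e with k₂ e = j ∧ f e = c, w₂ e
        ≤ 2 * W₂ + Fintype.card Q * M₂ := by
  suffices H : ∀ s : Finset E, ∃ f : E → Q,
      (∀ i c, Fintype.card Q * ∑ e ∈ s with k₁ e = i ∧ f e = c, w₁ e
        ≤ 2 * W₁ + Fintype.card Q * M₁) ∧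
      ∀ j c, Fintype.card Q * ∑ e ∈ s with k₂ e = j ∧ f e = c, w₂ e
        ≤ 2 * W₂ + Fintype.card Q * M₂ from H Finset.univ
  classical
  intro s
  induction s using Finset.induction_on with
  | empty => exact ⟨fun _ => Classical.arbitrary Q, by simp, by simp⟩
  | insert a s ha ih =>
    obtain ⟨f, hf₁, hf₂⟩ := ih
    have b₁ := two_mul_card_overloaded_lt s f k₁ w₁ (k₁ a) (W := W₁)
      ((Finset.sum_le_sum_of_subset (Finset.filter_subset_filter _ (Finset.subset_univ _))).trans
        (h₁ _))
    have b₂ := two_mul_card_overloaded_lt s f k₂ w₂ (k₂ a) (W := W₂)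
      ((Finset.sum_le_sum_of_subset (Finset.filter_subset_filter _ (Finset.subset_univ _))).trans
        (h₂ _))
    -- Each of the two keys of `a` excludes fewer than half of the colours, so some colour is
    -- admissible for both.
    obtain ⟨c, hc⟩ : ∃ c : Q, c ∉
        (Finset.univ.filter fun c : Q =>
          2 * W₁ < Fintype.card Q * ∑ e ∈ s with k₁ e = k₁ a ∧ f e = c, w₁ e) ∪
        (Finset.univ.filter fun c : Q =>
          2 * W₂ < Fintype.card Q * ∑ e ∈ s with k₂ e = k₂ a ∧ f e = c, w₂ e) := by
      by_contra! hall
      have := Finset.card_union_le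
        (Finset.univ.filter fun c : Q =>
          2 * W₁ < Fintype.card Q * ∑ e ∈ s with k₁ e = k₁ a ∧ f e = c, w₁ e)
        (Finset.univ.filter fun c : Q =>
          2 * W₂ < Fintype.card Q * ∑ e ∈ s with k₂ e = k₂ a ∧ f e = c, w₂ e)
      rw [Finset.eq_univ_iff_forall.2 hall, Finset.card_univ] at this
      omega
    simp only [Finset.mem_union, Finset.mem_filter, Finset.mem_univ, true_and, not_or,
      not_lt] at hc
    exact ⟨Function.update f a c,
      sum_filter_update_le s ha f k₁ w₁ (hM₁ a) c hf₁ hc.1,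
      sum_filter_update_le s ha f k₂ w₂ (hM₂ a) c hf₂ hc.2⟩

theorem exists_balanced_card [Nonempty Q] [Fintype E] (k : E → I) {W : ℕ}
    (h : ∀ i, (Finset.univ.filter fun e => k e = i).card ≤ W) :
    ∃ f : E → Q, ∀ i c, Fintype.card Q * (Finset.univ.filter fun e => k e = i ∧ f e = c).card
        ≤ 2 * W + Fintype.card Q := by
  obtain ⟨f, hf, -⟩ := exists_balanced₂ (Q := Q) k k (fun _ => 1) (fun _ => 1) (M₁ := 1) (M₂ := 1)
    (by simpa using h) (by simpa using h) (by simp) (by simp)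
  exact ⟨f, by simpa using hf⟩

theorem exists_balanced_partition [Nonempty Q] [Fintype E] (w : E → ℕ) {M : ℕ}
    (hM : ∀ e, w e ≤ M) :
    ∃ f : E → Q, ∀ c, Fintype.card Q * (Finset.univ.filter fun e => f e = c).card
        ≤ 2 * Fintype.card E + Fintype.card Q ∧
      Fintype.card Q * ∑ e with f e = c, w e ≤ 2 * ∑ e, w e + Fintype.card Q * M := by
  obtain ⟨f, hf₁, hf₂⟩ := exists_balanced₂ (Q := Q) (fun _ : E => ()) (fun _ : E => ())
    (fun _ => 1) w (W₁ := Fintype.card E) (W₂ := ∑ e, w e) (M₁ := 1) (by simp) (by simp)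
    (by simp) hM
  exact ⟨f, fun c => ⟨by simpa using hf₁ () c, by simpa using hf₂ () c⟩⟩

end Balance

/-! ### Communication with a fixed pattern -/

namespace Knowledge

variable {n B : ℕ} {X : Type*}

/-- Delivery of one message per item along the link from its source to its destination. -/
theorem reach_link {E : Type*} [Fintype E] (K : Knowledge n X) (src dst : E → Fin n) (r : ℕ)
    (hr : ∀ u v, (Finset.univ.filter fun e => src e = u ∧ dst e = v).card ≤ r)
    (p : E → X → Message B) (hp : ∀ e x x', K (src e) x x' → p e x = p e x') :
    Reach B r K (fun v x x' => K v x x' ∧ ∀ e, dst e = v → p e x = p e x') := by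
  classical
  -- The items on one link get distinct slots below `r`; the slot is the round of delivery.
  have hslot : ∃ slot : E → Fin r, ∀ e e', src e = src e' → dst e = dst e' → slot e = slot e' →
      e = e' := by
    have : ∀ u v, Nonempty ({e // e ∈ Finset.univ.filter fun e => src e = u ∧ dst e = v} ↪
        Fin r) := fun u v => Function.Embedding.nonempty_of_card_le (by
        rw [Fintype.card_coe, Fintype.card_fin]; exact hr u v)
    have emb := fun u v => (this u v).some
    refine ⟨fun e => emb (src e) (dst e) ⟨e, by simp⟩, fun e e' hs hd h => ?_⟩
    have aux : ∀ u v (hu : src e' = u) (hv : dst e' = v),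
        emb (src e') (dst e') ⟨e', by simp⟩ = emb u v ⟨e', by simp [hu, hv]⟩ := by
      rintro _ _ rfl rfl; rfl
    beta_reduce at h
    rw [aux _ _ hs.symm hd.symm] at h
    exact congrArg Subtype.val ((emb _ _).injective h)
  obtain ⟨slot, hslot⟩ := hslot
  suffices H : ∀ s ≤ r, Reach B s K
      (fun v x x' => K v x x' ∧ ∀ e, dst e = v → (slot e : ℕ) < s → p e x = p e x') by
    exact (H r le_rfl).mono_right fun v x x' hx => ⟨hx.1, fun e he => hx.2 e he (slot e).2⟩
  intro s hs
  induction s with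
  | zero => exact fun v x x' hx => ⟨hx, by simp⟩
  | succ s ih =>
    refine (ih (by omega)).trans (s := 1) ?_
    refine ⟨fun u v x => if h : ∃ e, src e = u ∧ dst e = v ∧ (slot e : ℕ) = s then p h.choose x
      else fun _ => false, ?_, ?_⟩
    · rintro u v x x' ⟨hx, -⟩
      beta_reduce
      split_ifs with h
      · exact hp _ _ _ (h.choose_spec.1.symm ▸ hx)
      · rfl
    · rintro v x x' ⟨⟨hx, hlt⟩, hM⟩
      refine ⟨hx, fun e he hes => ?_⟩
      rcases Nat.lt_succ_iff_lt_or_eq.1 hes with hes | hes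
      · exact hlt e he hes
      · have h : ∃ e', src e' = src e ∧ dst e' = v ∧ (slot e' : ℕ) = s := ⟨e, rfl, he, hes⟩
        have := hM (src e)
        simp only [dif_pos h] at this
        have hee : h.choose = e := hslot _ _ h.choose_spec.1 (h.choose_spec.2.1.trans he.symm)
          (Fin.ext (h.choose_spec.2.2.trans hes.symm))
        rwa [hee] at this

theorem exists_code {σ : Type*} (s : Finset σ) {d : ℕ} (hs : s.card ≤ 2 ^ (d * B)) :
    ∃ code : σ → Fin d → Message B, Set.InjOn code s := by
  classical
  have : Nonempty (s ↪ (Fin d → Message B)) :=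
    Function.Embedding.nonempty_of_card_le (by simpa [← pow_mul, mul_comm] using hs)
  obtain ⟨g⟩ := this
  refine ⟨fun a => if h : a ∈ s then g ⟨a, h⟩ else fun _ _ => false, fun a ha b hb hab => ?_⟩
  simp only [Finset.mem_coe] at ha hb
  simp only [dif_pos ha, dif_pos hb] at hab
  exact congrArg Subtype.val (g.injective hab)

theorem card_filter_prod_fin {E : Type*} [Fintype E] (d : ℕ) (P : E → Prop) [DecidablePred P] :
    (Finset.univ.filter fun e : E × Fin d => P e.1).card
      = d * (Finset.univ.filter fun e : E => P e).card := by
  have : (Finset.univ.filter fun e : E × Fin d => P e.1)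
      = (Finset.univ.filter fun e : E => P e) ×ˢ (Finset.univ : Finset (Fin d)) := by
    ext ⟨e, i⟩; simp
  rw [this, Finset.card_product, Finset.card_univ, Fintype.card_fin, mul_comm]

/-- Delivery of items that fit into `d` messages along the links from source to destination. -/
theorem reach_direct {E σ : Type*} [Fintype E] (K : Knowledge n X) (src dst : E → Fin n) {r : ℕ}
    (hr : ∀ u v, (Finset.univ.filter fun e => src e = u ∧ dst e = v).card ≤ r)
    (s : Finset σ) {d : ℕ} (hs : s.card ≤ 2 ^ (d * B)) (p : E → X → σ) (hps : ∀ e x, p e x ∈ s)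
    (hp : ∀ e x x', K (src e) x x' → p e x = p e x') :
    Reach B (d * r) K (fun v x x' => K v x x' ∧ ∀ e, dst e = v → p e x = p e x') := by
  obtain ⟨code, hcode⟩ := exists_code s hs
  refine (reach_link K (fun e : E × Fin d => src e.1) (fun e => dst e.1) (d * r) (fun u v => ?_)
    (fun e x => code (p e.1 x) e.2) ?_).mono_right ?_
  · rw [card_filter_prod_fin d fun e => src e = u ∧ dst e = v]
    exact Nat.mul_le_mul_left _ (hr u v)
  · intro e x x' hx
    simp only [hp _ _ _ hx]
  · rintro v x x' ⟨hx, h⟩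
    exact ⟨hx, fun e he => hcode (hps e x) (hps e x') (funext fun i => h (e, i) he)⟩

/-- Routing with a fixed pattern: if each node is the source of at most `D * n` items and the
destination of at most `D * n` items, then the items can be delivered in `O(D)` rounds. -/
theorem reach_route {E σ : Type*} [Fintype E] (K : Knowledge n X) (src dst : E → Fin n) {D : ℕ}
    (hsrc : ∀ u, (Finset.univ.filter fun e => src e = u).card ≤ D * n)
    (hdst : ∀ u, (Finset.univ.filter fun e => dst e = u).card ≤ D * n)
    (s : Finset σ) {d : ℕ} (hs : s.card ≤ 2 ^ (d * B)) (p : E → X → σ) (hps : ∀ e x, p e x ∈ s)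
    (hp : ∀ e x x', K (src e) x x' → p e x = p e x') :
    Reach B (2 * d * (2 * D + 1)) K
      (fun v x x' => K v x x' ∧ ∀ e, dst e = v → p e x = p e x') := by
  classical
  rcases Nat.eq_zero_or_pos n with rfl | hn
  · exact Reach.of_le fun v => v.elim0
  have : Nonempty (Fin n) := ⟨⟨0, hn⟩⟩
  -- Intermediate nodes are chosen so that every link, from source to `mid` and from `mid` to
  -- destination, carries at most `2 * D + 1` items.
  obtain ⟨mid, h₁, h₂⟩ := exists_balanced₂ (Q := Fin n) src dst (fun _ => 1) (fun _ => 1)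
    (M₁ := 1) (M₂ := 1) (by simpa using hsrc) (by simpa using hdst) (by simp) (by simp)
  have hle : ∀ a : ℕ, n * a ≤ 2 * (D * n) + n → a ≤ 2 * D + 1 := fun a ha =>
    Nat.le_of_mul_le_mul_left (by linarith) hn
  simp only [Fintype.card_fin, Finset.sum_const, smul_eq_mul, mul_one] at h₁ h₂
  have s₁ := reach_direct K src mid (fun u v => hle _ (h₁ u v)) s hs p hps hp
  have s₂ := reach_direct (fun v x x' => K v x x' ∧ ∀ e, mid e = v → p e x = p e x') mid dst
    (fun u v => hle _ (by simpa only [and_comm] using h₂ v u)) s hs p hps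
    (fun e x x' hx => hx.2 e rfl)
  refine ((s₁.trans s₂).mono_rounds (by linarith)).mono_right ?_
  exact fun v x x' hx => ⟨hx.1.1, hx.2⟩

/-- Each node tells all nodes the values of `r` functions with few values. -/
theorem reach_broadcast (K : Knowledge n X) {r : ℕ} (hB : n < 2 ^ B) (p : Fin r → Fin n → X → ℕ)
    (hpn : ∀ i v x, p i v x ≤ n) (hp : ∀ i v x x', K v x x' → p i v x = p i v x') :
    Reach B r K (fun v x x' => K v x x' ∧ ∀ i u, p i u x = p i u x') := by
  have := reach_direct K (fun e : Fin r × Fin n × Fin n => e.2.1) (fun e => e.2.2) (r := r) ?_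
    (Finset.range (n + 1)) (d := 1) (by simpa using hB) (fun e x => p e.1 e.2.1 x)
    (fun e x => Finset.mem_range_succ_iff.2 (hpn _ _ _)) (fun e x x' hx => hp _ _ _ _ hx)
  · refine (this.mono_rounds (by simp)).mono_right ?_
    exact fun v x x' hx => ⟨hx.1, fun i u => hx.2 (i, u, v) rfl⟩
  · intro u v
    have h := Finset.card_le_card_of_injOn (Prod.fst : Fin r × Fin n × Fin n → Fin r)
      (s := Finset.univ.filter fun e => e.2.1 = u ∧ e.2.2 = v) (t := Finset.univ)
      (fun _ _ => Finset.mem_univ _) (by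
        rintro ⟨i, a, b⟩ h ⟨j, a', b'⟩ h' hij
        simp_all)
    simpa using h

/-- Each node sends one value that fits into `d` messages to each node. -/
theorem reach_exchange {σ : Type*} (K : Knowledge n X) (s : Finset σ) {d : ℕ}
    (hs : s.card ≤ 2 ^ (d * B)) (p : Fin n → Fin n → X → σ) (hps : ∀ u v x, p u v x ∈ s)
    (hp : ∀ u v x x', K u x x' → p u v x = p u v x') :
    Reach B d K (fun v x x' => K v x x' ∧ ∀ u, p u v x = p u v x') := by
  have := reach_direct K (fun e : Fin n × Fin n => e.1) (fun e => e.2) (r := 1) ?_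
    s hs (fun e x => p e.1 e.2 x) (fun e x => hps _ _ _) (fun e x x' hx => hp _ _ _ _ hx)
  · refine (this.mono_rounds (by simp)).mono_right ?_
    exact fun v x x' hx => ⟨hx.1, fun u => hx.2 (u, v) rfl⟩
  · intro u v
    refine Finset.card_le_one.2 ?_
    rintro ⟨a, b⟩ h ⟨a', b'⟩ h'
    simp_all

end Knowledge

/-! ### Sparse times dense -/

theorem Finset.card_filter_embedding_le {E I N : Type*} [Fintype E] [DecidableEq I]
    [DecidableEq N] (node : I ↪ N) (f : E → I) {L : ℕ}
    (h : ∀ i, (Finset.univ.filter fun e => f e = i).card ≤ L) (u : N) :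
    (Finset.univ.filter fun e => node (f e) = u).card ≤ L := by
  by_cases hu : ∃ i, node i = u
  · obtain ⟨i, rfl⟩ := hu
    simpa using h i
  · rw [Finset.filter_false_of_mem fun e _ he => hu ⟨_, he⟩]
    simp

theorem Finset.card_filter_sigma_fin {I : Type*} [Fintype I] (a : I → ℕ) (P : I → Prop)
    [DecidablePred P] :
    (Finset.univ.filter fun e : Σ i, Fin (a i) => P e.1).card = ∑ i with P i, a i := by
  have : (Finset.univ.filter fun e : Σ i, Fin (a i) => P e.1)
      = (Finset.univ.filter P).sigma fun _ => Finset.univ := by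
    ext ⟨i, j⟩; simp
  rw [this, Finset.card_sigma]
  simp

theorem Finset.sum_filter_prod_eq {I J : Type*} [Fintype I] [Fintype J] [DecidableEq I]
    (w : I × J → ℕ) (i : I) (P : I × J → Prop) [DecidablePred P] :
    ∑ t with t.1 = i ∧ P t, w t = ∑ j with P (i, j), w (i, j) := by
  simp only [Finset.sum_filter, Fintype.sum_prod_type, ite_and]
  rw [Finset.sum_eq_single i] <;> simp +contextual

theorem Finset.exists_enumeration {α : Type*} [Nonempty α] (s : Finset α) :
    ∃ ρ : ℕ → α, ∀ a ∈ s, ∃ e < s.card, ρ e = a := by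
  refine ⟨fun e => s.toList.getD e (Classical.arbitrary α), fun a ha => ?_⟩
  obtain ⟨e, he, h⟩ := List.mem_iff_getElem.1 (Finset.mem_toList.2 ha)
  exact ⟨e, by simpa using he, (List.getD_eq_getElem _ _ he).trans h⟩

namespace Knowledge

variable {n B d q c : ℕ} {X R : Type*}

section FixedPattern

variable {K : Knowledge n X} {g : Fin n → Fin q} {h : Fin q → Fin n → Fin q}
  (node : Fin q × Fin q × Fin c ↪ Fin n)

/-- The nonzero entries of the blocks of a sparse matrix can be collected by the nodes that are
responsible for them. -/
theorem reach_sparse_blocks [Zero R] [DecidableEq R] {A : X → Fin n → Fin n → R} {V : Finset R}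
    (hB : n < 2 ^ B) (hV : V.card ≤ 2 ^ (d * B)) (hA : ∀ x i j, A x i j ∈ V)
    (hq : 1 ≤ q) (hqn : q ^ 3 ≤ n) (hcn : c * q ^ 2 ≤ n) (hnc : n ≤ 2 * c * q ^ 2)
    (cnt : Fin q → Fin n → ℕ)
    (hblock : ∀ i k, ∑ κ with h i κ = k, cnt i κ ≤ 37 * q * n)
    (hcol : ∀ κ, ∑ i, cnt i κ ≤ n)
    (hcnt : ∀ v x x', K v x x' → ∀ i κ,
      (Finset.univ.filter fun r => g r = i ∧ A x r κ ≠ 0).card = cnt i κ ∧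
      (Finset.univ.filter fun r => g r = i ∧ A x' r κ ≠ 0).card = cnt i κ)
    (hKA : ∀ v x x', K v x x' → ∀ r, A x r v = A x' r v) :
    Reach B (1196 * (d + 1) * q) K (fun v x x' => K v x x' ∧ ∀ t, node t = v → ∀ r κ,
      g r = t.1 → h t.1 κ = t.2.1 → A x r κ = A x' r κ) := by
  classical
  have hn : 0 < n := lt_of_lt_of_le (by positivity) hqn
  have hc : 0 < c := by
    rcases Nat.eq_zero_or_pos c with rfl | hc
    · simp at hnc; omega
    · exact hc
  have : Nonempty (Fin n) := ⟨⟨0, hn⟩⟩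
  have : Nonempty (Fin c) := ⟨⟨0, hc⟩⟩
  -- An item is the `e`-th nonzero entry of column `κ` within row group `i`. The pattern thus
  -- depends on the counts only; the row index travels with the value, whence `d + 1` words.
  let E : Type := Σ t : Fin q × Fin n, Fin (cnt t.1 t.2)
  let key : E → Fin q × Fin q := fun e => (e.1.1, h e.1.1 e.1.2)
  have hkey : ∀ b, (Finset.univ.filter fun e => key e = b).card ≤ 37 * q * n := by
    rintro ⟨i, k⟩
    refine le_of_eq_of_le ?_ (hblock i k)
    rw [← Finset.sum_filter_prod_eq (fun t => cnt t.1 t.2) i fun t => h t.1 t.2 = k,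
      ← Finset.card_filter_sigma_fin]
    refine congrArg _ (Finset.filter_congr ?_)
    rintro ⟨⟨i', κ⟩, e⟩ -
    simp [key]
  obtain ⟨a, ha⟩ := exists_balanced_card (Q := Fin c) key hkey
  have hkeya : ∀ b : (Fin q × Fin q) × Fin c,
      (Finset.univ.filter fun e => (key e, a e) = b).card ≤ 149 * q ^ 3 := by
    rintro ⟨b, j⟩
    have h1 := ha b j
    rw [Fintype.card_fin] at h1
    simp only [Prod.mk.injEq]
    refine Nat.le_of_mul_le_mul_left (h1.trans ?_) hc
    have h2 : 1 ≤ q ^ 3 := Nat.one_le_pow _ _ hq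
    calc 2 * (37 * q * n) + c ≤ 2 * (37 * q * (2 * c * q ^ 2)) + c * q ^ 3 := by gcongr; nlinarith
      _ = c * (149 * q ^ 3) := by ring
  let nd : (Fin q × Fin q) × Fin c ↪ Fin n :=
    (Equiv.prodAssoc _ _ _).toEmbedding.trans node
  choose ρ hρ using Finset.exists_enumeration (α := Fin n)
  let rows : X → Fin q → Fin n → Finset (Fin n) := fun x i κ =>
    Finset.univ.filter fun r => g r = i ∧ A x r κ ≠ 0
  have hrows : ∀ v x x', K v x x' → ∀ i, rows x i v = rows x' i v := fun v x x' hx i => by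
    simp only [rows, hKA v x x' hx]
  let p : E → X → Fin n × R := fun e x =>
    (ρ (rows x e.1.1 e.1.2) e.2, A x (ρ (rows x e.1.1 e.1.2) e.2) e.1.2)
  have hs : ((Finset.univ : Finset (Fin n)) ×ˢ V).card ≤ 2 ^ ((d + 1) * B) := by
    rw [Finset.card_product, Finset.card_univ, Fintype.card_fin, add_mul, one_mul, pow_add,
      mul_comm]
    exact Nat.mul_le_mul hV hB.le
  have hps : ∀ e x, p e x ∈ (Finset.univ : Finset (Fin n)) ×ˢ V := by
    simp [p, hA]
  -- A column owner cannot afford to send each entry to all `c` nodes of a block. It sends each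
  -- entry once, spread evenly over these nodes; in `s₂` they replicate what they got among
  -- themselves.
  have s₁ := reach_route (B := B) K (fun e : E => e.1.2) (fun e => nd (key e, a e)) (D := 149)
    (fun u => ?_) (fun u => ?_) _ hs p hps ?_
  rotate_left
  · refine le_trans ?_ (show n ≤ 149 * n by omega)
    refine le_of_eq_of_le ?_ (hcol u)
    rw [Finset.card_filter_sigma_fin (fun t : Fin q × Fin n => cnt t.1 t.2) fun t => t.2 = u]
    simp [Finset.sum_filter, Fintype.sum_prod_type]
  · exact (Finset.card_filter_embedding_le nd _ hkeya u).trans (Nat.mul_le_mul_left _ hqn)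
  · intro e x x' hx
    simp only [p, hrows _ _ _ hx, hKA _ _ _ hx]
  have s₂ := reach_route (B := B)
    (fun v x x' => K v x x' ∧ ∀ e : E, nd (key e, a e) = v → p e x = p e x')
    (fun e : E × Fin c => nd (key e.1, a e.1)) (fun e => nd (key e.1, e.2)) (D := 149 * q)
    (fun u => ?_) (fun u => ?_) _ hs (fun e x => p e.1 x) (fun e x => hps _ _)
    (fun e x x' hx => hx.2 _ rfl)
  rotate_left
  · rw [card_filter_prod_fin c fun e => nd (key e, a e) = u]
    refine (Nat.mul_le_mul_left c (Finset.card_filter_embedding_le nd _ hkeya u)).trans ?_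
    calc c * (149 * q ^ 3) = 149 * q * (c * q ^ 2) := by ring
      _ ≤ _ := Nat.mul_le_mul_left _ hcn
  · refine (Finset.card_filter_embedding_le (L := 37 * q * n) nd
      (fun e : E × Fin c => (key e.1, e.2)) ?_ u).trans (by gcongr; norm_num)
    rintro ⟨b, j⟩
    refine le_trans (Finset.card_le_card_of_injOn Prod.fst ?_ ?_) (hkey b)
    · rintro ⟨e, j'⟩ he
      simp_all
    · rintro ⟨e, j'⟩ he ⟨e', j''⟩ he' hee
      simp_all
  refine ((s₁.trans s₂).mono_rounds ?_).mono_right ?_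
  · nlinarith [Nat.zero_le d]
  · rintro v x x' ⟨⟨hK, -⟩, hp⟩
    refine ⟨hK, ?_⟩
    rintro ⟨i, k, j⟩ hv r κ hr hk
    have hpe : ∀ e : Fin (cnt i κ), p ⟨(i, κ), e⟩ x = p ⟨(i, κ), e⟩ x' := fun e =>
      hp (⟨(i, κ), e⟩, j) (by
        rw [← hv]
        exact congrArg node (Prod.ext rfl (Prod.ext hk rfl)))
    have hmem := hcnt v x x' hK i κ
    -- An entry that is nonzero in either input is among the items, and the row index in its message
    -- identifies it in the other input too; entries not announced are zero.
    by_cases h0 : A x r κ = 0 ∧ A x' r κ = 0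
    · rw [h0.1, h0.2]
    · rw [not_and_or] at h0
      rcases h0 with h0 | h0
      · obtain ⟨e, he, her⟩ := hρ (rows x i κ) r (by simp [rows, hr, h0])
        replace he := he.trans_eq hmem.1
        have := hpe ⟨e, he⟩
        simp only [p, her, Prod.mk.injEq] at this
        rw [this.2, ← this.1]
      · obtain ⟨e, he, her⟩ := hρ (rows x' i κ) r (by simp [rows, hr, h0])
        replace he := he.trans_eq hmem.2
        have := hpe ⟨e, he⟩
        simp only [p, her, Prod.mk.injEq] at this
        rw [← this.2, this.1]

end FixedPattern

end Knowledge

namespace Knowledge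

variable {n B d q c : ℕ} {X R : Type*}

section FixedPattern

variable {K : Knowledge n X} {g : Fin n → Fin q} {h : Fin q → Fin n → Fin q} {jg : Fin n → Fin c}
  (node : Fin q × Fin q × Fin c ↪ Fin n)

theorem card_filter_product_le {P Q : Fin n → Prop} [DecidablePred P] [DecidablePred Q]
    (hq : 1 ≤ q) (hP : q * (Finset.univ.filter P).card ≤ 3 * n)
    (hQ : (Finset.univ.filter Q).card ≤ 6 * q ^ 2) :
    (Finset.univ.filter P).card * (Finset.univ.filter Q).card ≤ 18 * q * n := by
  refine Nat.le_of_mul_le_mul_left ?_ hq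
  calc q * ((Finset.univ.filter P).card * (Finset.univ.filter Q).card)
      = q * (Finset.univ.filter P).card * (Finset.univ.filter Q).card := by ring
    _ ≤ 3 * n * (6 * q ^ 2) := Nat.mul_le_mul hP hQ
    _ = q * (18 * q * n) := by ring

/-- The blocks of the second matrix can be collected by the nodes that are responsible for
them. -/
theorem reach_dense_blocks {T : X → Fin n → Fin n → R} {V : Finset R}
    (hV : V.card ≤ 2 ^ (d * B)) (hT : ∀ x i j, T x i j ∈ V) (hq : 1 ≤ q)
    (hh : ∀ i k, q * (Finset.univ.filter fun κ => h i κ = k).card ≤ 3 * n)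
    (hjg : ∀ j, (Finset.univ.filter fun b => jg b = j).card ≤ 6 * q ^ 2)
    (hKT : ∀ v x x', K v x x' → T x v = T x' v) :
    Reach B (74 * d * q) K (fun v x x' => K v x x' ∧ ∀ t, node t = v → ∀ κ b,
      h t.1 κ = t.2.1 → jg b = t.2.2 → T x κ b = T x' κ b) := by
  -- A row of `T` is sent once per row group `i`, because the column partition `h i` depends on `i`:
  -- `q * n` items per sender.
  have s₁ := reach_route (B := B) K (fun e : Fin q × Fin n × Fin n => e.2.1)
    (fun e => node (e.1, h e.1 e.2.1, jg e.2.2)) (D := 18 * q)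
    (fun u => ?_) (fun u => ?_) _ hV (fun e x => T x e.2.1 e.2.2) (fun e x => hT _ _ _)
    (fun e x x' hx => by simp only [hKT _ _ _ hx])
  rotate_left
  · refine le_trans (b := q * n) ?_ (by gcongr; omega)
    refine le_trans (Finset.card_le_card_of_injOn (fun e => (e.1, e.2.2))
      (t := (Finset.univ : Finset (Fin q × Fin n))) (fun _ _ => Finset.mem_univ _) ?_) (by simp)
    rintro ⟨i, κ, b⟩ he ⟨i', κ', b'⟩ he' hee
    simp_all
  · refine Finset.card_filter_embedding_le node
      (fun e : Fin q × Fin n × Fin n => (e.1, h e.1 e.2.1, jg e.2.2)) ?_ u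
    rintro ⟨i, k, j⟩
    refine le_trans ?_ (card_filter_product_le hq (hh i k) (hjg j))
    rw [← Finset.card_product]
    refine Finset.card_le_card_of_injOn (fun e => e.2) ?_ ?_
    · rintro ⟨i', κ, b⟩ he
      simp only [Finset.coe_filter, Finset.mem_univ, true_and, Set.mem_ofPred_eq,
        Prod.mk.injEq] at he
      obtain ⟨rfl, hk, hj⟩ := he
      simp [hk, hj]
    · rintro ⟨i', κ, b⟩ he ⟨i'', κ', b'⟩ he' hee
      simp_all
  refine (s₁.mono_rounds (by nlinarith)).mono_right ?_
  rintro v x x' ⟨hK, hp⟩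
  refine ⟨hK, ?_⟩
  rintro ⟨i, k, j⟩ hv κ b hk hb
  exact hp (i, κ, b) (by
    rw [← hv]
    exact congrArg node (Prod.ext rfl (Prod.ext hk hb)))

/-- The nodes that are responsible for the blocks can deliver the partial sums to the rows. -/
theorem reach_partial_sums {F : X → Fin q → Fin n → Fin n → R} {V : Finset R}
    (hV : V.card ≤ 2 ^ (d * B)) (hF : ∀ x k i j, F x k i j ∈ V) (hq : 1 ≤ q)
    (hg : ∀ i, q * (Finset.univ.filter fun r => g r = i).card ≤ 3 * n)
    (hjg : ∀ j, (Finset.univ.filter fun b => jg b = j).card ≤ 6 * q ^ 2)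
    (hK : ∀ x x' k r b, K (node (g r, k, jg b)) x x' → F x k r b = F x' k r b) :
    Reach B (74 * d * q) K (fun v x x' => ∀ k b, F x k v b = F x' k v b) := by
  have s₁ := reach_route (B := B) K (fun e : Fin n × Fin q × Fin n => node (g e.1, e.2.1, jg e.2.2))
    (fun e => e.1) (D := 18 * q)
    (fun u => ?_) (fun u => ?_) _ hV (fun e x => F x e.2.1 e.1 e.2.2) (fun e x => hF _ _ _ _)
    (fun e x x' hx => hK _ _ _ _ _ hx)
  rotate_left
  · refine Finset.card_filter_embedding_le node
      (fun e : Fin n × Fin q × Fin n => (g e.1, e.2.1, jg e.2.2)) ?_ u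
    rintro ⟨i, k, j⟩
    refine le_trans ?_ (card_filter_product_le hq (hg i) (hjg j))
    rw [← Finset.card_product]
    refine Finset.card_le_card_of_injOn (fun e => (e.1, e.2.2)) ?_ ?_
    · rintro ⟨r, k', b⟩ he
      simp only [Finset.coe_filter, Finset.mem_univ, true_and, Set.mem_ofPred_eq,
        Prod.mk.injEq] at he
      simp [he]
    · rintro ⟨r, k', b⟩ he ⟨r', k'', b'⟩ he' hee
      simp_all
  · refine le_trans (b := q * n) ?_ (by gcongr; omega)
    refine le_trans (Finset.card_le_card_of_injOn (fun e => e.2)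
      (t := (Finset.univ : Finset (Fin q × Fin n))) (fun _ _ => Finset.mem_univ _) ?_) (by simp)
    rintro ⟨r, k, b⟩ he ⟨r', k', b'⟩ he' hee
    simp_all
  refine (s₁.mono_rounds (by nlinarith)).mono_right ?_
  exact fun v x x' hx k b => hx.2 (v, k, b) rfl

end FixedPattern

/-! ### Choice of the partitions and assembly of the product -/

section Product

variable [AddCommMonoid R] [DecidableEq R] (mul : R → R → R) {K : Knowledge n X}
  {A T : X → Fin n → Fin n → R} {V : Finset R}

/-- `mul` is an arbitrary operation, so that the reversed multiplication of a noncommutative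
semiring is covered. Zeros need not absorb: nodes learn whole blocks, including the position of the
zeros. -/
theorem reach_product_of_partition (hB : n < 2 ^ B) (hV : V.card ≤ 2 ^ (d * B))
    (hA : ∀ x i j, A x i j ∈ V) (hT : ∀ x i j, T x i j ∈ V)
    (hsum : ∀ x i j (s : Finset (Fin n)), ∑ k ∈ s, mul (A x i k) (T x k j) ∈ V)
    (hKA : ∀ v x x', K v x x' → ∀ r, A x r v = A x' r v)
    (hKT : ∀ v x x', K v x x' → T x v = T x' v)
    (hq : 1 ≤ q) (hqn : q ^ 3 ≤ n) {g : Fin n → Fin q} {h : Fin q → Fin n → Fin q}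
    (hg : ∀ i, q * (Finset.univ.filter fun r => g r = i).card ≤ 3 * n)
    (hh : ∀ i k, q * (Finset.univ.filter fun κ => h i κ = k).card ≤ 3 * n)
    (cnt : Fin q → Fin n → ℕ)
    (hblock : ∀ i k, ∑ κ with h i κ = k, cnt i κ ≤ 37 * q * n)
    (hcol : ∀ κ, ∑ i, cnt i κ ≤ n)
    (hcnt : ∀ v x x', K v x x' → ∀ i κ,
      (Finset.univ.filter fun r => g r = i ∧ A x r κ ≠ 0).card = cnt i κ ∧
      (Finset.univ.filter fun r => g r = i ∧ A x' r κ ≠ 0).card = cnt i κ) :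
    Reach B (1344 * (d + 1) * q) K (fun v x x' => ∀ b,
      ∑ κ, mul (A x v κ) (T x κ b) = ∑ κ, mul (A x' v κ) (T x' κ b)) := by
  have hn : 0 < n := lt_of_lt_of_le (by positivity) hqn
  have hq2 : q ^ 2 ≤ n := (Nat.pow_le_pow_right hq (by norm_num)).trans hqn
  have hq2' : 0 < q ^ 2 := by positivity
  set c := n / q ^ 2 with hc_def
  have hc : 0 < c := Nat.div_pos hq2 hq2'
  have hcn : c * q ^ 2 ≤ n := Nat.div_mul_le_self _ _
  have hnc : n ≤ 2 * c * q ^ 2 := by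
    have h1 := Nat.lt_div_mul_add (a := n) hq2'
    rw [← hc_def] at h1
    nlinarith
  have : Nonempty (Fin c) := ⟨⟨0, hc⟩⟩
  obtain ⟨jg, hjg⟩ : ∃ jg : Fin n → Fin c,
      ∀ j, (Finset.univ.filter fun b => jg b = j).card ≤ 6 * q ^ 2 := by
    obtain ⟨jg, hjg⟩ := exists_balanced_partition (Q := Fin c) (fun _ : Fin n => 0) (M := 0)
      (fun _ => le_rfl)
    simp only [Fintype.card_fin] at hjg
    refine ⟨jg, fun j => Nat.le_of_mul_le_mul_left ((hjg j).1.trans ?_) hc⟩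
    nlinarith
  obtain ⟨node⟩ : Nonempty (Fin q × Fin q × Fin c ↪ Fin n) :=
    Function.Embedding.nonempty_of_card_le (by simp; nlinarith)
  have s₁ := reach_sparse_blocks (K := K) (h := h) node hB hV hA hq hqn hcn hnc cnt hblock hcol
    hcnt hKA
  have s₂ := reach_dense_blocks (K := fun v x x' => K v x x' ∧ ∀ t, node t = v → ∀ r κ,
      g r = t.1 → h t.1 κ = t.2.1 → A x r κ = A x' r κ) (h := h) (jg := jg) node hV hT hq hh hjg
      (fun v x x' hx => hKT v x x' hx.1)
  have s₃ := reach_partial_sums (B := B) (K := fun v x x' => (K v x x' ∧ ∀ t, node t = v → ∀ r κ,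
      g r = t.1 → h t.1 κ = t.2.1 → A x r κ = A x' r κ) ∧ ∀ t, node t = v → ∀ κ b,
      h t.1 κ = t.2.1 → jg b = t.2.2 → T x κ b = T x' κ b) (g := g) (jg := jg) node
      (F := fun x k r b => ∑ κ with h (g r) κ = k, mul (A x r κ) (T x κ b)) hV
      (fun x k i j => hsum _ _ _ _) hq hg hjg ?_
  · refine ((s₁.trans (s₂.trans s₃)).mono_rounds (by nlinarith)).mono_right ?_
    intro v x x' hx b
    rw [← Finset.sum_fiberwise _ (h (g v)), ← Finset.sum_fiberwise _ (h (g v))]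
    exact Finset.sum_congr rfl fun k _ => hx k b
  · rintro x x' k r b ⟨⟨-, h₁⟩, h₂⟩
    refine Finset.sum_congr rfl fun κ hκ => ?_
    rw [h₁ _ rfl r κ rfl (Finset.mem_filter.1 hκ).2, h₂ _ rfl κ b (Finset.mem_filter.1 hκ).2 rfl]

/-- The product of a matrix with few nonzero entries and an arbitrary matrix. -/
theorem reach_product (hB : n < 2 ^ B) (hV : V.card ≤ 2 ^ (d * B))
    (hA : ∀ x i j, A x i j ∈ V) (hT : ∀ x i j, T x i j ∈ V)
    (hsum : ∀ x i j (s : Finset (Fin n)), ∑ k ∈ s, mul (A x i k) (T x k j) ∈ V)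
    (hKA : ∀ v x x', K v x x' → ∀ r, A x r v = A x' r v)
    (hKA' : ∀ v x x', K v x x' → A x v = A x' v)
    (hKT : ∀ v x x', K v x x' → T x v = T x' v)
    (hq : 1 ≤ q) (hqn : q ^ 3 ≤ n)
    (hnz : ∀ v x x', K v x x' →
      ∑ r, (Finset.univ.filter fun κ => A x r κ ≠ 0).card ≤ 8 * q ^ 3 * n) :
    Reach B (1346 * (d + 1) * q) K (fun v x x' => ∀ b,
      ∑ κ, mul (A x v κ) (T x κ b) = ∑ κ, mul (A x' v κ) (T x' κ b)) := by
  have hn : 0 < n := lt_of_lt_of_le (by positivity) hqn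
  have hq1 : q ≤ n := (Nat.le_self_pow (by norm_num) q).trans hqn
  have hq2 : 1 ≤ q ^ 2 := Nat.one_le_pow _ _ hq
  have : Nonempty (Fin q) := ⟨⟨0, hq⟩⟩
  have hcard : ∀ (P : Fin n → Prop) [DecidablePred P], (Finset.univ.filter P).card ≤ n :=
    fun P _ => (Finset.card_le_univ _).trans (by simp)
  -- the numbers of nonzero entries of the rows
  let rc : X → Fin n → ℕ := fun x r => (Finset.univ.filter fun κ => A x r κ ≠ 0).card
  have s₁ := reach_broadcast (B := B) K (r := 1) hB (fun _ r x => rc x r)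
    (fun _ _ _ => hcard _) (fun _ v x x' hx => by simp only [rc, hKA' _ _ _ hx])
  refine (s₁.trans (s := q + 1344 * (d + 1) * q) ?_).mono_rounds (by nlinarith)
  -- The row counts are now constants, so all nodes can agree on a partition `g` computed from them.
  refine Reach.cases rc (fun v x x' hx => funext fun r => hx.2 0 r) fun v x₀ x₁ hx₀ => ?_
  have hrc : ∑ r, rc x₀ r ≤ 8 * q ^ 3 * n := hnz v x₀ x₁ hx₀.1
  obtain ⟨g, hg⟩ := exists_balanced_partition (Q := Fin q) (rc x₀) (M := n) fun _ => hcard _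
  simp only [Fintype.card_fin] at hg
  have hg₁ : ∀ i, q * (Finset.univ.filter fun r => g r = i).card ≤ 3 * n := fun i =>
    (hg i).1.trans (by omega)
  have hg₂ : ∀ i, ∑ r with g r = i, rc x₀ r ≤ 17 * q ^ 2 * n := fun i => by
    refine Nat.le_of_mul_le_mul_left ((hg i).2.trans ?_) hq
    calc 2 * ∑ r, rc x₀ r + q * n ≤ 2 * (8 * q ^ 3 * n) + q * (q ^ 2 * n) := by
          gcongr; nlinarith
      _ = q * (17 * q ^ 2 * n) := by ring
  clear hg hx₀
  -- the numbers of nonzero entries of the columns in each group of rows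
  let cnt : X → Fin q → Fin n → ℕ := fun x i κ =>
    (Finset.univ.filter fun r => g r = i ∧ A x r κ ≠ 0).card
  set K₁ : Knowledge n X := fix (fun v x x' => K v x x' ∧ ∀ (i : Fin 1) u, rc x u = rc x' u) rc
    (rc x₀) with hK₁
  have s₂ := reach_broadcast (B := B) K₁ hB (fun i κ x => cnt x i κ)
    (fun _ _ _ => hcard _) (fun _ v x x' hx => by simp only [cnt, hKA _ _ _ hx.1.1])
  refine s₂.trans ?_
  refine Reach.cases cnt (fun v x x' hx => funext fun i => funext fun κ => hx.2 i κ)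
    fun v x₂ x₃ hx₂ => ?_
  have hsumcnt : ∀ i, ∑ κ, cnt x₂ i κ ≤ 17 * q ^ 2 * n := fun i => by
    refine le_of_eq_of_le ?_ (hg₂ i)
    rw [← hx₂.1.2.1]
    simp only [cnt, rc, Finset.card_filter, Finset.sum_filter]
    rw [Finset.sum_comm]
    simp only [ite_and]
    refine Finset.sum_congr rfl fun r _ => ?_
    split_ifs <;> simp
  have hcnt3 : ∀ i κ, cnt x₂ i κ ≤ 3 * n / q := fun i κ => by
    rw [Nat.le_div_iff_mul_le hq, mul_comm]
    refine le_trans (Nat.mul_le_mul_left _ (Finset.card_le_card ?_)) (hg₁ i)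
    intro r hr
    simp_all
  choose h hh using fun i =>
    exists_balanced_partition (Q := Fin q) (cnt x₂ i) (M := 3 * n / q) (hcnt3 i)
  simp only [Fintype.card_fin] at hh
  refine reach_product_of_partition (K := (fix (fun v x x' => K₁ v x x' ∧ ∀ (i : Fin q) u,
      cnt x i u = cnt x' i u) cnt (cnt x₂))) mul hB hV hA hT hsum
    (fun v x x' hx => hKA _ _ _ hx.1.1.1.1) (fun v x x' hx => hKT _ _ _ hx.1.1.1.1) hq hqn
    (g := g) (h := h) hg₁ (fun i k => (hh i k).1.trans (by omega)) (cnt x₂) (fun i k => ?_)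
    (fun κ => ?_) (fun v x x' hx i κ => ?_)
  · refine Nat.le_of_mul_le_mul_left ((hh i k).2.trans ?_) hq
    have h1 : q * (3 * n / q) ≤ 3 * n := Nat.mul_div_le _ _
    calc 2 * ∑ κ, cnt x₂ i κ + q * (3 * n / q) ≤ 2 * (17 * q ^ 2 * n) + 3 * (q ^ 2 * n) := by
          have := hsumcnt i
          nlinarith
      _ = q * (37 * q * n) := by ring
  · refine le_of_eq_of_le ?_ (hcard fun r => A x₂ r κ ≠ 0)
    rw [Finset.card_eq_sum_card_fiberwise (f := g) (t := Finset.univ)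
      (fun _ _ => Finset.mem_coe.2 (Finset.mem_univ _))]
    simp only [cnt, Finset.filter_filter, and_comm]
  · exact ⟨congrFun (congrFun hx.2.1 i) κ, congrFun (congrFun hx.2.2 i) κ⟩

end Product

end Knowledge

/-! ### The algorithm -/

theorem nz_eq_sum {n : ℕ} {R : Type u} [Semiring R] [DecidableEq R]
    (A : Matrix (Fin n) (Fin n) R) :
    nz A = ∑ r, (Finset.univ.filter fun κ => A r κ ≠ 0).card := by
  rw [nz, Set.ncard_eq_toFinset_card', Set.toFinset_ofPred, Finset.card_filter,
    Fintype.sum_prod_type]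
  simp only [Finset.card_filter]

theorem nz_le {n : ℕ} {R : Type u} [Semiring R] (A : Matrix (Fin n) (Fin n) R) :
    nz A ≤ n * n := by
  refine (Set.ncard_le_ncard (Set.subset_univ _)).trans ?_
  simp [Set.ncard_univ]

/-- The number of groups into which rows and columns are partitioned: an integer that is close to
the cube root of `m / n`. -/
theorem exists_group_number {n : ℕ} (hn : 0 < n) : ∃ q : ℕ → ℕ, ∀ m ≤ n * n,
    1 ≤ q m ∧ q m ^ 3 ≤ n ∧ m ≤ 8 * q m ^ 3 * n ∧
      (q m : ℝ) ≤ ((m : ℝ) / n) ^ (1 / 3 : ℝ) + 1 := by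
  -- `m ≤ n * n` bounds the cube of the root by `n`, and the root is at most `2 * max 1 ⌊y⌋₊`, which
  -- explains the factor `8 = 2 ^ 3`.
  refine ⟨fun m => max 1 ⌊((m : ℝ) / n) ^ (1 / 3 : ℝ)⌋₊, fun m hm => ?_⟩
  beta_reduce
  set y : ℝ := ((m : ℝ) / n) ^ (1 / 3 : ℝ) with hy
  have hn' : (0 : ℝ) < n := by exact_mod_cast hn
  have hy0 : 0 ≤ y := by positivity
  have hy3 : y ^ 3 = m / n := by
    rw [hy, ← Real.rpow_natCast, ← Real.rpow_mul (by positivity)]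
    norm_num
  have hmn : (m : ℝ) = y ^ 3 * n := by rw [hy3]; field_simp
  have hyn : y ^ 3 ≤ n := by
    rw [hy3, div_le_iff₀ hn']
    exact_mod_cast hm
  have hfl : (⌊y⌋₊ : ℝ) ≤ y := Nat.floor_le hy0
  have hlt : y < ⌊y⌋₊ + 1 := Nat.lt_floor_add_one y
  refine ⟨le_max_left _ _, ?_, ?_, ?_⟩
  · rcases max_choice 1 ⌊y⌋₊ with h | h <;> rw [h]
    · rw [one_pow]
      exact hn
    · have : (⌊y⌋₊ : ℝ) ^ 3 ≤ n := (pow_le_pow_left₀ (by positivity) hfl 3).trans hyn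
      exact_mod_cast this
  · have h2 : y ≤ 2 * (max 1 ⌊y⌋₊ : ℕ) := by
      have h3 : ((⌊y⌋₊ : ℕ) : ℝ) ≤ (max 1 ⌊y⌋₊ : ℕ) := by exact_mod_cast le_max_right _ _
      have h4 : (1 : ℝ) ≤ (max 1 ⌊y⌋₊ : ℕ) := by exact_mod_cast le_max_left _ _
      linarith
    have h5 : (m : ℝ) ≤ 8 * (max 1 ⌊y⌋₊ : ℕ) ^ 3 * n := by
      rw [hmn]
      have := pow_le_pow_left₀ hy0 h2 3
      gcongr
      linarith [mul_pow (2 : ℝ) (max 1 ⌊y⌋₊ : ℕ) 3]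
    exact_mod_cast h5
  · rcases max_choice 1 ⌊y⌋₊ with h | h <;> rw [h]
    · simpa using hy0
    · linarith

namespace Knowledge

variable {n B d : ℕ} {R : Type u} [Semiring R]

/-- Two matrices whose entries and partial sums lie in `V`. -/
abbrev ValuedPair (n : ℕ) {R : Type u} [Semiring R] (V : Finset R) : Type u :=
  {P : Matrix (Fin n) (Fin n) R × Matrix (Fin n) (Fin n) R // ValuesIn V P.1 P.2}

theorem ValuedPair.mul_mem {V : Finset R} (x : ValuedPair n V) (i j : Fin n) :
    (x.1.1 * x.1.2) i j ∈ V := by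
  rw [Matrix.mul_apply]
  exact x.2.2.2 i j Finset.univ

/-- After an exchange of columns and of the numbers of nonzero entries of the rows, the product
can be computed in `O(q)` rounds. -/
theorem reach_matrix_product (hB : n < 2 ^ B) {V : Finset R} (hV : V.card ≤ 2 ^ (d * B))
    {q m : ℕ} (hq : 1 ≤ q) (hqn : q ^ 3 ≤ n) (hm : m ≤ 8 * q ^ 3 * n)
    (K : Knowledge n (ValuedPair n V))
    (hrow : ∀ v x x', K v x x' → x.1.1 v = x'.1.1 v ∧ x.1.2 v = x'.1.2 v)
    (hcol : ∀ v x x', K v x x' → ∀ u, x.1.1 u v = x'.1.1 u v ∧ x.1.2 u v = x'.1.2 u v)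
    (hnz : (∀ v x x', K v x x' → nz x.1.1 ≤ m) ∨ ∀ v x x', K v x x' → nz x.1.2 ≤ m) :
    Reach B (1347 * (d + 1) * q) K
      (fun v x x' => (x.1.1 * x.1.2) v = (x'.1.1 * x'.1.2) v) := by
  classical
  rcases hnz with hnz | hnz
  · refine ((reach_product (fun a b : R => a * b) (A := fun x : ValuedPair n V => x.1.1)
      (T := fun x => x.1.2) hB hV
      (fun x => x.2.1) (fun x => x.2.2.1) (fun x => x.2.2.2)
      (fun v x x' hx r => (hcol v x x' hx r).1)
      (fun v x x' hx => (hrow v x x' hx).1) (fun v x x' hx => (hrow v x x' hx).2) hq hqn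
      (fun v x x' hx => ?_)).mono_rounds (by gcongr; norm_num)).mono_right ?_
    · rw [← nz_eq_sum]
      exact (hnz v x x' hx).trans hm
    · intro v x x' hx
      funext b
      rw [Matrix.mul_apply, Matrix.mul_apply]
      exact hx b
  -- If the second matrix is the sparse one, the transposed product is computed with the reversed
  -- multiplication. Node `v` then holds column `v` of the product, and one exchange turns columns
  -- into rows.
  · have s₁ := reach_product (fun a b : R => b * a) (K := K) (A := fun x : ValuedPair n V => x.1.2.transpose)
      (T := fun x => x.1.1.transpose) hB hV
      (fun x i j => x.2.2.1 j i) (fun x i j => x.2.1 j i) (fun x i j => x.2.2.2 j i)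
      (fun v x x' hx r => congrFun (hrow v x x' hx).2 r)
      (fun v x x' hx => funext fun u => (hcol v x x' hx u).2)
      (fun v x x' hx => funext fun u => (hcol v x x' hx u).1) hq hqn
      (fun v x x' hx => ?_)
    · refine ((s₁.trans (reach_exchange _ V hV
        (fun u v (x : ValuedPair n V) => (x.1.1 * x.1.2) v u) (fun u v x => x.mul_mem v u) fun u v x x' hx => ?_)).mono_rounds ?_).mono_right ?_
      · rw [Matrix.mul_apply, Matrix.mul_apply]
        exact hx v
      · nlinarith
      · exact fun v x x' hx => funext hx.2
    · refine le_of_eq_of_le ?_ ((hnz v x x' hx).trans hm)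
      rw [nz_eq_sum]
      simp only [Finset.card_filter]
      rw [Finset.sum_comm]
      rfl

theorem solves_matrix_product (hB : n < 2 ^ B) {V : Finset R}
    (hV : V.card ≤ 2 ^ (d * B)) {q : ℕ → ℕ}
    (hq : ∀ m ≤ n * n, 1 ≤ q m ∧ q m ^ 3 ≤ n ∧ m ≤ 8 * q m ^ 3 * n) :
    Solves B (fun v (x x' : ValuedPair n V) => (x.1.1 v, x.1.2 v) = (x'.1.1 v, x'.1.2 v))
      (fun v x x' => (x.1.1 * x.1.2) v = (x'.1.1 * x'.1.2) v)
      (fun x => 2 * d + 2 + 1347 * (d + 1) * q (min (nz x.1.1) (nz x.1.2))) := by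
  classical
  have hcard : ∀ (P : Fin n → Prop) [DecidablePred P], (Finset.univ.filter P).card ≤ n :=
    fun P _ => (Finset.card_le_univ _).trans (by simp)
  set K : Knowledge n (ValuedPair n V) :=
    fun v x x' => (x.1.1 v, x.1.2 v) = (x'.1.1 v, x'.1.2 v) with hK
  have hK₁ : ∀ v x x', K v x x' → x.1.1 v = x'.1.1 v := fun v x x' hx => congrArg Prod.fst hx
  have hK₂ : ∀ v x x', K v x x' → x.1.2 v = x'.1.2 v := fun v x x' hx => congrArg Prod.snd hx
  have s₁ := reach_exchange (B := B) K V hV (fun u v x => x.1.1 u v) (fun u v x => x.2.1 u v)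
    (fun u v x x' hx => congrFun (hK₁ _ _ _ hx) v)
  have s₂ := reach_exchange (B := B)
    (fun v x x' => K v x x' ∧ ∀ u, x.1.1 u v = x'.1.1 u v) V hV (fun u v x => x.1.2 u v)
    (fun u v x => x.2.2.1 u v) (fun u v x x' hx => congrFun (hK₂ _ _ _ hx.1) v)
  have s₃ := reach_broadcast (B := B)
    (fun v (x x' : ValuedPair n V) => (K v x x' ∧ ∀ u, x.1.1 u v = x'.1.1 u v) ∧
      ∀ u, x.1.2 u v = x'.1.2 u v) hB
    (r := 2) (fun i v x => (Finset.univ.filter fun κ => ![x.1.1, x.1.2] i v κ ≠ 0).card)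
    (fun _ _ _ => hcard _) (by
      intro i v x x' hx
      refine congrArg (fun a : Fin n → R => (Finset.univ.filter fun κ => a κ ≠ 0).card) ?_
      fin_cases i
      · exact hK₁ _ _ _ hx.1.1
      · exact hK₂ _ _ _ hx.1.1)
  have s := (s₁.trans s₂).trans s₃
  rw [← two_mul] at s
  refine s.solves ?_
  -- The row counts, broadcast in `s₃`, reveal `nz` of both matrices to all nodes, hence which one
  -- is sparser and which `q` to use.
  refine Solves.cases (fun x : ValuedPair n V => (nz x.1.1, nz x.1.2))
    (r := fun a => 1347 * (d + 1) * q (min a.1 a.2)) ?_ fun x₀ => ?_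
  · intro v x x' hx
    simp only [nz_eq_sum]
    refine congrArg₂ Prod.mk (Finset.sum_congr rfl fun u _ => ?_)
      (Finset.sum_congr rfl fun u _ => ?_)
    · exact hx.2 0 u
    · exact hx.2 1 u
  · obtain ⟨hq₁, hq₂, hq₃⟩ := hq (min (nz x₀.1.1) (nz x₀.1.2)) ((min_le_left _ _).trans (nz_le _))
    refine (reach_matrix_product hB hV hq₁ hq₂ hq₃ _
      (fun v x x' hx => ⟨hK₁ _ _ _ hx.1.1.1.1, hK₂ _ _ _ hx.1.1.1.1⟩)
      (fun v x x' hx u => ⟨hx.1.1.1.2 u, hx.1.1.2 u⟩) ?_).solves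
      (Solves.of_le (fun _ _ _ hx => hx) fun _ => 0)
    have h₁ : ∀ {γ δ : Type} {a b : γ} {c e : δ}, (a, c) = (b, e) → a = b ∧ c = e := by simp
    rcases le_total (nz x₀.1.1) (nz x₀.1.2) with h | h
    · rw [min_eq_left h]
      exact Or.inl fun v x x' hx => (h₁ hx.2.1).1.le
    · rw [min_eq_right h]
      exact Or.inr fun v x x' hx => (h₁ hx.2.1).2.le

end Knowledge

/-- Values are encoded by `κ * wordBits n` bits, and messages have `β * wordBits n` bits. The
algorithm may depend on `n`, on the semiring and on the value set, but not on `S`, `T`, or the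
numbers of their nonzero entries; the constant `C` depends on `κ` and `β` only. -/
theorem mainTheorem6 (κ β : ℕ) (hβ : 1 ≤ β) :
    ∃ C : ℝ, ∀ (n : ℕ) (R : Type u) [Semiring R] (V : Finset R),
      V.card ≤ 2 ^ (κ * wordBits n) →
      ∃ A : MatMulAlgorithm n (β * wordBits n) R,
        ∀ (S T : Matrix (Fin n) (Fin n) R) (m : ℕ), ValuesIn V S T → min (nz S) (nz T) = m →
          ∃ r : ℕ, (r : ℝ) ≤ C * (((m : ℝ) / n) ^ (1 / 3 : ℝ) + 1) ∧
            A.ComputesWithin (fun v => (S v, T v)) (fun v => (S * T) v) r := by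
  refine ⟨1349 * (κ + 1), fun n R _ V hV => ?_⟩
  -- For `n = 0` no `q ≥ 1` has `q ^ 3 ≤ n`, but there is no node that has to output anything.
  rcases Nat.eq_zero_or_pos n with rfl | hn
  · obtain ⟨A, hA⟩ := Knowledge.Solves.exists_algorithm (B := β * wordBits 0) (r := fun _ => 0)
      (fun (x : Knowledge.ValuedPair 0 V) v => (x.1.1 v, x.1.2 v)) (fun x v => (x.1.1 * x.1.2) v)
      (Knowledge.Solves.of_le (fun v => v.elim0) _)
    exact ⟨A, fun S T m hST _ => ⟨0, by push_cast; positivity, hA ⟨(S, T), hST⟩⟩⟩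
  · have hw : wordBits n ≤ β * wordBits n := Nat.le_mul_of_pos_left _ hβ
    have hB : n < 2 ^ (β * wordBits n) :=
      (Nat.le_pow_clog one_lt_two (n + 1)).trans (Nat.pow_le_pow_right two_pos hw)
    obtain ⟨q, hq⟩ := exists_group_number hn
    obtain ⟨A, hA⟩ := Knowledge.Solves.exists_algorithm
      (fun (x : Knowledge.ValuedPair n V) v => (x.1.1 v, x.1.2 v)) (fun x v => (x.1.1 * x.1.2) v)
      (Knowledge.solves_matrix_product hB
        (hV.trans (Nat.pow_le_pow_right two_pos (Nat.mul_le_mul_left κ hw)))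
        fun m hm => ⟨(hq m hm).1, (hq m hm).2.1, (hq m hm).2.2.1⟩)
    refine ⟨A, fun S T m hST hm => ⟨_, ?_, hA ⟨(S, T), hST⟩⟩⟩
    simp only [hm]
    obtain ⟨h₁, -, -, h₂⟩ := hq m (hm ▸ (min_le_left _ _).trans (nz_le S))
    calc ((2 * κ + 2 + 1347 * (κ + 1) * q m : ℕ) : ℝ) ≤ ((1349 * (κ + 1) * q m : ℕ) : ℝ) := by
          norm_cast
          nlinarith
      _ = 1349 * (κ + 1) * (q m : ℝ) := by push_cast; ring
      _ ≤ _ := mul_le_mul_of_nonneg_left h₂ (by positivity)
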